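/- Let $n\in\mathbb{N}$ and order $\mathbb{R}^n$ coordinatewise. A map $f:\mathbb{R}^n\to\mathbb{R}^n$ is *monotone* if $x\le y$ implies $f(x)\le f(y)$, and (additively) *homogeneous* if $f(c+x)=c+f(x)$ for all $c\in\mathbb{R}$ and $x\in\mathbb{R}^n$, where $c+x=(c+x_1,\dots,c+x_n)$. An *eigenvector* of $f$ is a vector $v\in\mathbb{R}^n$ such that $f(v)=\lambda+v$ for some $\lambda\in\mathbb{R}$. The *recession function* of $f$ is $\widehat f(x)=\lim_{\mu\to+\infty}\mu^{-1}f(\mu x)$; we say that it exists if this limit exists in $\mathbb{R}^n$ for every $x\in\mathbb{R}^n$. An $\mathbb{R}^n$-valued map is *convex* if all its coordinates are convex functions. For a directed graph, a *class* is an equivalence class of nodes for the relation "$i=j$, or there are directed paths from $i$ to $j$ and from $j$ to $i$". A class is *final* if no directed path leads from it to a node outside it. The graph of an $n\times n$ stochastic matrix $P$ has nodes $1,\dots,n$ and an arc $i\to j$ whenever $P_{ij}\neq 0$. The *final graph* of $P$ is the union of the restrictions of this graph to its final classes. For a convex monotone homogeneous map $g:\mathbb{R}^n\to\mathbb{R}^n$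 and $v\in\mathbb{R}^n$, the *subdifferential* is $$\partial g(v)=\{P\in\mathbb{R}^{n\times n} : g(x)-g(v)\ge P(x-v)\ \text{ for all } x\in\mathbb{R}^n\},$$ and all its elements are stochastic matrices. If $g$ has an eigenvector $v$, the *critical graph* of $g$ is the union of the final graphs of the matrices $P\in\partial g(v)$ (it does not depend on the choice of the eigenvector $v$), and the *critical classes* of $g$ are the classes of its critical graph. **Corollary.** Let $f:\mathbb{R}^n\to\mathbb{R}^n$ be monotone and homogeneous. Suppose that its recession function $\widehat f$ exists and is convex (so that $\widehat f$ is a convex monotone homogeneous map with eigenvector $0$), and that $\widehat f$ has exactly one critical class. Then $f$ has an eigenvector. -/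

import Mathlib

open Filter Topology

/-- `f : ℝⁿ → ℝⁿ` is (additively) homogeneous: `f (c + x) = c + f x` for every real `c`, where
`c + x` denotes the vector with entries `c + xᵢ`. -/
def AddHomogeneous {n : ℕ} (f : (Fin n → ℝ) → (Fin n → ℝ)) : Prop :=
  ∀ (c : ℝ) (x : Fin n → ℝ), f (fun i => c + x i) = fun i => c + f x i

/-- `v ∈ ℝⁿ` is an (additive) eigenvector of `f`: `f v = c + v` for some real eigenvalue `c`. -/
def IsAddEigenvector {n : ℕ} (f : (Fin n → ℝ) → (Fin n → ℝ)) (v : Fin n → ℝ) : Prop :=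
  ∃ c : ℝ, f v = fun i => c + v i

/-- `g` is the recession function of `f`: the limit defining it exists at every point `x`, and
`g x = lim_{μ → +∞} μ⁻¹ f (μ x)`. -/
def IsRecessionFunction {n : ℕ} (f g : (Fin n → ℝ) → (Fin n → ℝ)) : Prop :=
  ∀ x : Fin n → ℝ, Tendsto (fun μ : ℝ => μ⁻¹ • f (μ • x)) atTop (𝓝 (g x))

/-- A map into `ℝⁿ` is convex when each of its coordinates is convex. -/
def CoordConvex {n : ℕ} (f : (Fin n → ℝ) → (Fin n → ℝ)) : Prop :=
  ∀ i : Fin n, ConvexOn ℝ Set.univ (fun x => f x i)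

/-- The subdifferential of `f : ℝⁿ → ℝⁿ` at `v`: the matrices `P` such that
`f x - f v ≥ P (x - v)` (entrywise) for all `x`. -/
def vecSubdifferential {n : ℕ} (f : (Fin n → ℝ) → (Fin n → ℝ)) (v : Fin n → ℝ) :
    Set (Matrix (Fin n) (Fin n) ℝ) :=
  {P | ∀ x : Fin n → ℝ, P.mulVec (x - v) ≤ f x - f v}

/-- A directed graph (loops allowed) whose nodes form a subset of `V`. -/
structure NodeDigraph (V : Type*) where
  /-- the set of nodes -/
  nodes : Set V
  /-- the arcs `i → j` -/
  Arc : V → V → Prop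
  left_mem : ∀ {i j : V}, Arc i j → i ∈ nodes
  right_mem : ∀ {i j : V}, Arc i j → j ∈ nodes

/-- `i` has access to `j`: `i = j`, or there is a directed path from `i` to `j`. -/
def NodeDigraph.HasAccess {V : Type*} (G : NodeDigraph V) (i j : V) : Prop :=
  Relation.ReflTransGen G.Arc i j

/-- `C` is a class of `G`: an equivalence class of nodes for mutual access, that is, the set of
nodes of a strongly connected component of `G`. -/
def NodeDigraph.IsClass {V : Type*} (G : NodeDigraph V) (C : Set V) : Prop :=
  ∃ i ∈ G.nodes, C = {j | j ∈ G.nodes ∧ G.HasAccess i j ∧ G.HasAccess j i}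

/-- `C` is a final class of `G`: no node of `C` has access to a node outside `C`. -/
def NodeDigraph.IsFinalClass {V : Type*} (G : NodeDigraph V) (C : Set V) : Prop :=
  G.IsClass C ∧ ∀ i ∈ C, ∀ j : V, G.HasAccess i j → j ∈ C

/-- The graph of a square matrix `P`: all indices are nodes, with an arc `i → j` when
`P i j ≠ 0`. -/
def matrixDigraph {n : ℕ} (P : Matrix (Fin n) (Fin n) ℝ) : NodeDigraph (Fin n) where
  nodes := Set.univ
  Arc i j := P i j ≠ 0
  left_mem _ := Set.mem_univ _
  right_mem _ := Set.mem_univ _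

/-- The final graph of `P`: the union, over the final classes `F` of the graph of `P`, of the
restrictions of that graph to `F`. -/
def finalDigraph {n : ℕ} (P : Matrix (Fin n) (Fin n) ℝ) : NodeDigraph (Fin n) where
  nodes := {i | ∃ F, (matrixDigraph P).IsFinalClass F ∧ i ∈ F}
  Arc i j := ∃ F, (matrixDigraph P).IsFinalClass F ∧ i ∈ F ∧ j ∈ F ∧ (matrixDigraph P).Arc i j
  left_mem := fun ⟨F, hF, hi, _, _⟩ => ⟨F, hF, hi⟩
  right_mem := fun ⟨F, hF, _, hj, _⟩ => ⟨F, hF, hj⟩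

/-- The final graph of a set `S` of matrices: the union of the final graphs of its members. -/
def finalDigraphOfSet {n : ℕ} (S : Set (Matrix (Fin n) (Fin n) ℝ)) : NodeDigraph (Fin n) where
  nodes := {i | ∃ P ∈ S, i ∈ (finalDigraph P).nodes}
  Arc i j := ∃ P ∈ S, (finalDigraph P).Arc i j
  left_mem := fun ⟨P, hP, h⟩ => ⟨P, hP, (finalDigraph P).left_mem h⟩
  right_mem := fun ⟨P, hP, h⟩ => ⟨P, hP, (finalDigraph P).right_mem h⟩

/-- The critical graph of `f`, computed at the eigenvector `v` of `f`: the union of the final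
graphs of the matrices in the subdifferential of `f` at `v`. For a convex monotone homogeneous
map, this graph is the same for all eigenvectors `v`. -/
def criticalDigraphAt {n : ℕ} (f : (Fin n → ℝ) → (Fin n → ℝ)) (v : Fin n → ℝ) :
    NodeDigraph (Fin n) :=
  finalDigraphOfSet (vecSubdifferential f v)

/-- `C` is a critical class of `f`: a class of the critical graph of `f`, computed at some
eigenvector `v` of `f` (for a convex monotone homogeneous map the choice of `v` is irrelevant). -/
def IsCriticalClass {n : ℕ} (f : (Fin n → ℝ) → (Fin n → ℝ)) (C : Set (Fin n)) : Prop :=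
  ∃ v : Fin n → ℝ, IsAddEigenvector f v ∧ (criticalDigraphAt f v).IsClass C

/-! Nonexpansiveness of `f` gives, for each `0 ≤ α < 1`, a fixed point of `x ↦ f (α x)`. Subtracting
from it one of its coordinates produces `w_α`, with that coordinate zero, and a bounded scalar `c_α`
such that `f (α w_α) = c_α + w_α`. As `α → 1`, either `w_α` stays bounded and accumulates at an
eigenvector of `f`, or `w_α / ‖w_α‖` accumulates at a fixed point of the recession function `g` of
`f`; this fixed point has norm one and a zero coordinate, so it is not constant.

The second alternative is excluded when `g` is convex with one critical class. If `g z = z`, then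
every `P ∈ ∂g(0)` satisfies `P z ≤ z`, so by the minimum principle `z` is constant on the final
classes of `P`, hence on the critical class of `g`. By Hahn–Banach some `P ∈ ∂g(0)` satisfies
`P z = z`, and for this `P` both extrema of `z` are attained on final classes. -/

section Ultrafilter

variable {ι : Type*} {U : Ultrafilter ι}

theorem exists_mem_tendsto_of_isCompact {X : Type*} [TopologicalSpace X] {s : Set X}
    (hs : IsCompact s) {u : ι → X} (hu : ∀ᶠ k in (U : Filter ι), u k ∈ s) :
    ∃ x ∈ s, Tendsto u U (𝓝 x) :=
  hs.ultrafilter_le_nhds' (U.map u) hu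

theorem tendsto_atTop_or_exists_eventually_le {α : Type*} [LinearOrder α] (U : Ultrafilter ι)
    (u : ι → α) : Tendsto u U atTop ∨ ∃ B, ∀ᶠ k in (U : Filter ι), u k ≤ B := by
  refine or_iff_not_imp_right.2 fun hunbdd => tendsto_atTop.2 fun B => ?_
  have hB : ∀ᶠ k in (U : Filter ι), ¬u k ≤ B :=
    Ultrafilter.eventually_not.2 fun hB => hunbdd ⟨B, hB⟩
  exact hB.mono fun k hk => (not_le.1 hk).le

theorem exists_norm_eq_one_tendsto_inv_norm_smul {E : Type*} [NormedAddCommGroup E]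
    [NormedSpace ℝ E] [ProperSpace E] {u : ι → E} (hu : ∀ᶠ k in (U : Filter ι), u k ≠ 0) :
    ∃ z, ‖z‖ = 1 ∧ Tendsto (fun k => ‖u k‖⁻¹ • u k) U (𝓝 z) := by
  have hsphere : ∀ᶠ k in (U : Filter ι), ‖u k‖⁻¹ • u k ∈ Metric.sphere (0 : E) 1 :=
    hu.mono fun k hk => mem_sphere_zero_iff_norm.2 (by simp [norm_smul, hk])
  obtain ⟨z, hz, hlim⟩ := exists_mem_tendsto_of_isCompact (isCompact_sphere 0 1) hsphere
  exact ⟨z, mem_sphere_zero_iff_norm.1 hz, hlim⟩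

end Ultrafilter

theorem exists_map_smul_eq_self_of_lipschitzWith {𝕜 E : Type*} [NormedField 𝕜]
    [NormedAddCommGroup E] [NormedSpace 𝕜 E] [CompleteSpace E] {f : E → E} {K : NNReal}
    (hf : LipschitzWith K f) {a : 𝕜} (ha : K * ‖a‖₊ < 1) :
    ∃ x, f (a • x) = x ∧ (1 - K * ‖a‖) * ‖x‖ ≤ ‖f 0‖ := by
  have hcontr : ContractingWith (K * ‖a‖₊) (fun x => f (a • x)) :=
    ⟨ha, hf.comp (lipschitzWith_smul a)⟩
  refine ⟨hcontr.fixedPoint, hcontr.fixedPoint_isFixedPt, ?_⟩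
  have hpos : 0 < 1 - K * ‖a‖ := sub_pos.2 (by exact_mod_cast ha)
  have hdist := hcontr.dist_fixedPoint_le 0
  rw [smul_zero, dist_zero_left, dist_zero_left, NNReal.coe_mul, coe_nnnorm] at hdist
  rwa [mul_comm, ← le_div_iff₀ hpos]

section Sublinear

variable {E F : Type*} [AddCommGroup E] [Module ℝ E] [AddCommGroup F] [Module ℝ F]

theorem map_zero_of_map_smul_of_pos {p : E → F}
    (hp : ∀ r : ℝ, 0 < r → ∀ x, p (r • x) = r • p x) : p 0 = 0 := by
  have h := hp 2 two_pos 0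
  rwa [smul_zero, two_smul, left_eq_add] at h

variable {p : E → ℝ}

theorem map_add_le_of_convexOn (hp : ∀ r : ℝ, 0 < r → ∀ x, p (r • x) = r • p x)
    (hconv : ConvexOn ℝ Set.univ p) (x y : E) : p (x + y) ≤ p x + p y := by
  have hxy := hconv.2 (Set.mem_univ ((2 : ℝ) • x)) (Set.mem_univ ((2 : ℝ) • y))
    one_half_pos.le one_half_pos.le (add_halves 1)
  simpa [hp 2 two_pos] using hxy

theorem smul_le_map_smul_of_convexOn (hp : ∀ r : ℝ, 0 < r → ∀ x, p (r • x) = r • p x)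
    (hconv : ConvexOn ℝ Set.univ p) (t : ℝ) (z : E) : t • p z ≤ p (t • z) := by
  rcases lt_trichotomy t 0 with ht | rfl | ht
  · have hcancel := map_add_le_of_convexOn hp hconv (t • z) ((-t) • z)
    rw [← add_smul, add_neg_cancel, zero_smul, map_zero_of_map_smul_of_pos hp,
      hp (-t) (neg_pos.2 ht), neg_smul] at hcancel
    linarith
  · simp [map_zero_of_map_smul_of_pos hp]
  · exact (hp t ht z).ge

theorem exists_linearMap_le_and_apply_eq (hp : ∀ r : ℝ, 0 < r → ∀ x, p (r • x) = r • p x)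
    (hconv : ConvexOn ℝ Set.univ p) (z : E) :
    ∃ φ : E →ₗ[ℝ] ℝ, (∀ x, φ x ≤ p x) ∧ φ z = p z := by
  have hwell : ∀ t : ℝ, t • z = 0 → RingHom.id ℝ t • p z = 0 := by
    intro t ht
    rcases smul_eq_zero.1 ht with rfl | rfl
    · simp
    · simp [map_zero_of_map_smul_of_pos hp]
  obtain ⟨φ, hφz, hφ⟩ := exists_extension_of_le_sublinear
    (LinearPMap.mkSpanSingleton' z (p z) hwell) p hp (map_add_le_of_convexOn hp hconv) (by
      rintro ⟨x, hx⟩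
      obtain ⟨t, rfl⟩ := Submodule.mem_span_singleton.1 hx
      rw [LinearPMap.mkSpanSingleton'_apply]
      exact smul_le_map_smul_of_convexOn hp hconv t z)
  refine ⟨φ, hφ, ?_⟩
  exact (hφz ⟨z, Submodule.mem_span_singleton_self z⟩).trans
    (LinearPMap.mkSpanSingleton'_apply_self z (p z) hwell _)

end Sublinear

theorem eq_of_sum_mul_le_of_forall_le {ι R : Type*} [Ring R] [LinearOrder R]
    [IsStrictOrderedRing R] {s : Finset ι} {p z : ι → R} {m : R} (hp : ∀ j ∈ s, 0 ≤ p j)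
    (hsum : ∑ j ∈ s, p j = 1) (hle : ∑ j ∈ s, p j * z j ≤ m)
    (hm : ∀ j ∈ s, p j ≠ 0 → m ≤ z j) {j : ι} (hjs : j ∈ s) (hj : p j ≠ 0) : z j = m := by
  have hterm : ∀ k ∈ s, p k * m ≤ p k * z k := by
    intro k hk
    by_cases hpk : p k = 0
    · simp [hpk]
    · exact mul_le_mul_of_nonneg_left (hm k hk hpk) (hp k hk)
  have hsum_le : ∑ k ∈ s, p k * z k ≤ ∑ k ∈ s, p k * m := by
    rwa [← Finset.sum_mul, hsum, one_mul]
  have heq := (Finset.sum_eq_sum_iff_of_le hterm).1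
    ((Finset.sum_le_sum hterm).antisymm hsum_le) j hjs
  exact (mul_left_cancel₀ hj heq).symm

namespace NodeDigraph

variable {V : Type*} {G : NodeDigraph V} {C S : Set V} {i j : V}

/-- A set of nodes is invariant when no arc leaves it; this is the form in which accessibility
and final classes are used in the minimum principle. -/
def IsInvariant (G : NodeDigraph V) (S : Set V) : Prop :=
  ∀ ⦃i j⦄, i ∈ S → G.Arc i j → j ∈ S

theorem IsInvariant.mem_of_hasAccess (hS : G.IsInvariant S) (hi : i ∈ S)
    (hij : G.HasAccess i j) : j ∈ S := by
  induction hij with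
  | refl => exact hi
  | tail _ hjk ih => exact hS ih hjk

theorem IsClass.nonempty (hC : G.IsClass C) : C.Nonempty := by
  obtain ⟨i, hi, rfl⟩ := hC
  exact ⟨i, hi, .refl, .refl⟩

theorem IsClass.hasAccess (hC : G.IsClass C) (hi : i ∈ C) (hj : j ∈ C) : G.HasAccess i j := by
  obtain ⟨r, -, rfl⟩ := hC
  exact Relation.ReflTransGen.trans hi.2.2 hj.2.1

theorem IsFinalClass.isInvariant (hC : G.IsFinalClass C) : G.IsInvariant C :=
  fun i j hi hij => hC.2 i hi j (.single hij)

theorem hasAccess_of_subsingleton_classes (hG : {C | G.IsClass C}.Subsingleton)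
    (hi : i ∈ G.nodes) (hj : j ∈ G.nodes) : G.HasAccess i j := by
  have hclass := hG ⟨i, hi, rfl⟩ ⟨j, hj, rfl⟩
  have hmem : j ∈ {k | k ∈ G.nodes ∧ G.HasAccess i k ∧ G.HasAccess k i} :=
    hclass ▸ ⟨hj, .refl, .refl⟩
  exact hmem.2.1

theorem IsInvariant.exists_isFinalClass_subset (hS : G.IsInvariant S) (hfin : S.Finite)
    (hne : S.Nonempty) (hnodes : S ⊆ G.nodes) : ∃ F, G.IsFinalClass F ∧ F ⊆ S := by
  obtain ⟨i, hi, hmin⟩ := hfin.exists_minimalFor (fun i => {j | G.HasAccess i j}) S hne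
  have hreach : ∀ {j}, G.HasAccess i j → j ∈ S := fun hij => hS.mem_of_hasAccess hi hij
  have hback : ∀ {j}, G.HasAccess i j → G.HasAccess j i := fun hij =>
    hmin (hreach hij) (fun _ hjk => Relation.ReflTransGen.trans hij hjk) .refl
  refine ⟨_, ⟨⟨i, hnodes hi, rfl⟩, ?_⟩, fun j hj => hreach hj.2.1⟩
  rintro j ⟨-, hij, -⟩ k hjk
  have hik : G.HasAccess i k := Relation.ReflTransGen.trans hij hjk
  exact ⟨hnodes (hreach hik), hik, hback hik⟩

end NodeDigraph

section Stochastic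

open Matrix

variable {n : ℕ} {P : Matrix (Fin n) (Fin n) ℝ} {z : Fin n → ℝ}

theorem isInvariant_setOf_eq_of_mulVec_le (hP : P ∈ rowStochastic ℝ (Fin n)) (hz : P *ᵥ z ≤ z)
    {S : Set (Fin n)} (hS : (matrixDigraph P).IsInvariant S) {m : ℝ} (hm : ∀ i ∈ S, m ≤ z i) :
    (matrixDigraph P).IsInvariant {i ∈ S | z i = m} := by
  rintro i j ⟨hiS, hi⟩ hij
  exact ⟨hS hiS hij, eq_of_sum_mul_le_of_forall_le (fun _ _ => nonneg_of_mem_rowStochastic hP)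
    (sum_row_of_mem_rowStochastic hP i) ((hz i).trans_eq hi) (fun k _ hk => hm k (hS hiS hk))
    (Finset.mem_univ j) hij⟩

theorem apply_eq_of_mem_isFinalClass (hP : P ∈ rowStochastic ℝ (Fin n)) (hz : P *ᵥ z ≤ z)
    {F : Set (Fin n)} (hF : (matrixDigraph P).IsFinalClass F) {i j : Fin n} (hi : i ∈ F)
    (hj : j ∈ F) : z i = z j := by
  obtain ⟨m, hmF, hmin⟩ := Set.exists_min_image F z F.toFinite ⟨i, hi⟩
  have hconst : ∀ k ∈ F, z k = z m := fun k hk =>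
    ((isInvariant_setOf_eq_of_mulVec_le hP hz hF.isInvariant hmin).mem_of_hasAccess
      ⟨hmF, rfl⟩ (hF.1.hasAccess hmF hk)).2
  rw [hconst i hi, hconst j hj]

theorem exists_mem_finalDigraph_forall_le [NeZero n] (hP : P ∈ rowStochastic ℝ (Fin n))
    (hz : P *ᵥ z ≤ z) : ∃ i ∈ (finalDigraph P).nodes, ∀ j, z i ≤ z j := by
  obtain ⟨m, hmin⟩ := Finite.exists_min z
  have hinv : (matrixDigraph P).IsInvariant {i ∈ Set.univ | z i = z m} :=
    isInvariant_setOf_eq_of_mulVec_le hP hz (fun _ _ _ _ => trivial) fun i _ => hmin i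
  obtain ⟨F, hF, hFmin⟩ :=
    hinv.exists_isFinalClass_subset (Set.toFinite _) ⟨m, trivial, rfl⟩ fun _ _ => trivial
  obtain ⟨i, hi⟩ := hF.1.nonempty
  exact ⟨i, ⟨F, hF, hi⟩, fun j => (hFmin hi).2.trans_le (hmin j)⟩

end Stochastic

section CriticalGraph

open Matrix

variable {n : ℕ} {g : (Fin n → ℝ) → (Fin n → ℝ)} {v z : Fin n → ℝ}

theorem mem_rowStochastic_of_mem_vecSubdifferential (hmono : Monotone g)
    (hhom : AddHomogeneous g) {P : Matrix (Fin n) (Fin n) ℝ} (hP : P ∈ vecSubdifferential g v) :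
    P ∈ rowStochastic ℝ (Fin n) := by
  refine mem_rowStochastic_iff_sum.2 ⟨fun i j => ?_, fun i => ?_⟩
  · have hsub := hP (v - Pi.single j 1) i
    have hle : g (v - Pi.single j 1) i ≤ g v i :=
      hmono (sub_le_self v (Pi.single_nonneg.2 zero_le_one)) i
    rw [sub_sub_cancel_left, mulVec_neg, mulVec_single_one] at hsub
    simp only [Pi.neg_apply, Pi.sub_apply, col_apply] at hsub
    linarith
  · have hle : ∀ c : ℝ, (∑ j, P i j) * c ≤ c := by
      intro c
      have hsub := hP (fun i => c + v i) i
      rw [hhom] at hsub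
      simpa [mulVec, dotProduct, Finset.sum_mul] using hsub
    linarith [hle 1, hle (-1)]

theorem exists_mem_vecSubdifferential_zero_mulVec_eq (hconv : CoordConvex g)
    (hsmul : ∀ r : ℝ, 0 < r → ∀ x, g (r • x) = r • g x) (z : Fin n → ℝ) :
    ∃ P ∈ vecSubdifferential g 0, P *ᵥ z = g z := by
  choose φ hφ hφz using fun i =>
    exists_linearMap_le_and_apply_eq (fun r hr x => congrFun (hsmul r hr x) i) (hconv i) z
  refine ⟨LinearMap.toMatrix' (LinearMap.pi φ), fun x => ?_, ?_⟩
  · rw [LinearMap.toMatrix'_mulVec, map_zero_of_map_smul_of_pos hsmul, sub_zero, sub_zero]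
    exact fun i => hφ i x
  · rw [LinearMap.toMatrix'_mulVec]
    exact funext hφz

theorem sub_apply_eq_of_hasAccess_criticalDigraphAt (hmono : Monotone g)
    (hhom : AddHomogeneous g) (hz : g z - g v ≤ z - v) {i j : Fin n}
    (hij : (criticalDigraphAt g v).HasAccess i j) : (z - v) i = (z - v) j := by
  have hinv : (criticalDigraphAt g v).IsInvariant {k | (z - v) i = (z - v) k} := by
    rintro k l hk ⟨P, hP, F, hF, hkF, hlF, -⟩
    exact hk.trans <| apply_eq_of_mem_isFinalClass
      (mem_rowStochastic_of_mem_vecSubdifferential hmono hhom hP) ((hP z).trans hz) hF hkF hlF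
  exact hinv.mem_of_hasAccess rfl hij

theorem apply_eq_of_isFixedPt_of_subsingleton_classes (hmono : Monotone g)
    (hhom : AddHomogeneous g) (hconv : CoordConvex g)
    (hsmul : ∀ r : ℝ, 0 < r → ∀ x, g (r • x) = r • g x)
    (hcrit : {C | (criticalDigraphAt g 0).IsClass C}.Subsingleton)
    (hz : Function.IsFixedPt g z) (i j : Fin n) : z i = z j := by
  have : NeZero n := ⟨by rintro rfl; exact i.elim0⟩
  obtain ⟨P, hP, hPz⟩ := exists_mem_vecSubdifferential_zero_mulVec_eq hconv hsmul z
  rw [hz.eq] at hPz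
  have hP_stoch := mem_rowStochastic_of_mem_vecSubdifferential hmono hhom hP
  obtain ⟨a, ha, hmin⟩ := exists_mem_finalDigraph_forall_le hP_stoch hPz.le
  obtain ⟨b, hb, hmax⟩ := exists_mem_finalDigraph_forall_le (z := -z) hP_stoch
    (by rw [mulVec_neg, hPz])
  have hab : z a = z b := by
    simpa using sub_apply_eq_of_hasAccess_criticalDigraphAt (z := z) hmono hhom
      (by rw [hz.eq, map_zero_of_map_smul_of_pos hsmul])
      (NodeDigraph.hasAccess_of_subsingleton_classes hcrit ⟨P, hP, ha⟩ ⟨P, hP, hb⟩)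
  have hconst : ∀ k, z k = z a := fun k =>
    ((neg_le_neg_iff.1 (hmax k)).trans_eq hab.symm).antisymm (hmin k)
  rw [hconst i, hconst j]

end CriticalGraph

namespace AddHomogeneous

variable {n : ℕ} {f : (Fin n → ℝ) → (Fin n → ℝ)}

theorem lipschitzWith_one (hhom : AddHomogeneous f) (hmono : Monotone f) :
    LipschitzWith 1 f := by
  have hcoord : ∀ i, LipschitzWith 1 fun x => f x i := by
    refine fun i => LipschitzWith.of_le_add fun x y => ?_
    have hxy : x ≤ fun j => dist x y + y j := fun j => by
      linarith [le_abs_self (x j - y j), Real.dist_eq (x j) (y j), dist_le_pi_dist x y j]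
    have hfxy := hmono hxy i
    rw [hhom] at hfxy
    exact hfxy.trans_eq (add_comm _ _)
  exact LipschitzWith.of_dist_le_mul fun x y =>
    (dist_pi_le_iff (by positivity)).2 fun i => (hcoord i).dist_le_mul x y

theorem exists_map_smul_eq_add (hhom : AddHomogeneous f) (hf : LipschitzWith 1 f) (o : Fin n)
    {a : ℝ} (ha : a ∈ Set.Ico 0 1) :
    ∃ (w : Fin n → ℝ) (c : ℝ), w o = 0 ∧ ‖c‖ ≤ ‖f 0‖ ∧ f (a • w) = fun i => c + w i := by
  obtain ⟨x, hx, hbound⟩ := exists_map_smul_eq_self_of_lipschitzWith hf (a := a)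
    (by simpa [← NNReal.coe_lt_coe, abs_of_nonneg ha.1] using ha.2)
  rw [NNReal.coe_one, one_mul, Real.norm_of_nonneg ha.1] at hbound
  have h1a : 0 ≤ 1 - a := sub_nonneg.2 ha.2.le
  refine ⟨fun i => x i - x o, (1 - a) * x o, sub_self _, ?_, ?_⟩
  · rw [norm_mul, Real.norm_of_nonneg h1a]
    exact (mul_le_mul_of_nonneg_left (norm_le_pi_norm x o) h1a).trans hbound
  · have hshift : (a • fun i => x i - x o) = fun i => -(a * x o) + (a • x) i := by
      funext i
      simp only [Pi.smul_apply, smul_eq_mul]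
      ring
    rw [hshift, hhom, hx]
    funext i
    ring

end AddHomogeneous

theorem map_eq_add_of_tendsto {ι κ : Type*} {l : Filter ι} [l.NeBot]
    {f : (κ → ℝ) → (κ → ℝ)} (hf : Continuous f) {a c : ι → ℝ} {w : ι → κ → ℝ} {c₀ : ℝ}
    {v : κ → ℝ} (ha : Tendsto a l (𝓝 1)) (hc : Tendsto c l (𝓝 c₀)) (hw : Tendsto w l (𝓝 v))
    (heq : ∀ᶠ k in l, f (a k • w k) = fun i => c k + w k i) : f v = fun i => c₀ + v i := by
  have haw : Tendsto (fun k => a k • w k) l (𝓝 v) := by simpa using ha.smul hw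
  have hadd : Tendsto (fun k i => c k + w k i) l (𝓝 fun i => c₀ + v i) :=
    tendsto_pi_nhds.2 fun i => hc.add (tendsto_pi_nhds.1 hw i)
  exact tendsto_nhds_unique_of_eventuallyEq ((hf.tendsto v).comp haw) hadd heq

namespace IsRecessionFunction

variable {n : ℕ} {f g : (Fin n → ℝ) → (Fin n → ℝ)}

theorem map_smul (hrec : IsRecessionFunction f g) (r : ℝ) (hr : 0 < r) (x : Fin n → ℝ) :
    g (r • x) = r • g x := by
  refine tendsto_nhds_unique (hrec (r • x)) ?_
  have hμr : Tendsto (fun μ : ℝ => μ * r) atTop atTop := tendsto_id.atTop_mul_const hr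
  refine (((hrec x).comp hμr).const_smul r).congr fun μ => ?_
  rw [Function.comp_apply, smul_smul, smul_smul, mul_inv_rev, mul_inv_cancel_left₀ hr.ne']

theorem monotone (hrec : IsRecessionFunction f g) (hmono : Monotone f) : Monotone g := by
  intro x y hxy
  refine le_of_tendsto_of_tendsto (hrec x) (hrec y) ?_
  filter_upwards [eventually_ge_atTop 0] with μ hμ
  have hμinv : 0 ≤ μ⁻¹ := inv_nonneg.2 hμ
  have hfxy : f (μ • x) ≤ f (μ • y) := hmono (smul_le_smul_of_nonneg_left hxy hμ)
  exact smul_le_smul_of_nonneg_left hfxy hμinv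

theorem addHomogeneous (hrec : IsRecessionFunction f g) (hhom : AddHomogeneous f) :
    AddHomogeneous g := by
  intro c x
  refine tendsto_nhds_unique (hrec _) ?_
  refine ((hrec x).const_add fun _ => c).congr' ?_
  filter_upwards [eventually_ne_atTop 0] with μ hμ
  have hshift : (μ • fun j => c + x j) = fun j => μ * c + (μ • x) j := by
    funext j
    simp [mul_add]
  rw [hshift, hhom]
  funext i
  simp only [Pi.add_apply, Pi.smul_apply, smul_eq_mul, mul_add, inv_mul_cancel_left₀ hμ]

variable {ι : Type*} {l : Filter ι}

theorem tendsto_inv_smul_map_smul (hrec : IsRecessionFunction f g) {K : NNReal}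
    (hf : LipschitzWith K f) {μ : ι → ℝ} {x : ι → Fin n → ℝ} {z : Fin n → ℝ}
    (hμ : Tendsto μ l atTop) (hx : Tendsto x l (𝓝 z)) :
    Tendsto (fun k => (μ k)⁻¹ • f (μ k • x k)) l (𝓝 (g z)) := by
  refine ((hrec z).comp hμ).congr_dist ?_
  have hzero : Tendsto (fun k => K * dist z (x k)) l (𝓝 0) := by
    simpa using ((tendsto_const_nhds (x := z)).dist hx).const_mul (K : ℝ)
  refine squeeze_zero' (.of_forall fun _ => dist_nonneg) ?_ hzero
  filter_upwards [hμ.eventually_gt_atTop 0] with k hk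
  calc dist ((μ k)⁻¹ • f (μ k • z)) ((μ k)⁻¹ • f (μ k • x k))
      = (μ k)⁻¹ * dist (f (μ k • z)) (f (μ k • x k)) := by
        rw [dist_smul₀, Real.norm_of_nonneg (inv_nonneg.2 hk.le)]
    _ ≤ (μ k)⁻¹ * (K * dist (μ k • z) (μ k • x k)) := by
        gcongr
        exact hf.dist_le_mul _ _
    _ = K * dist z (x k) := by
        rw [dist_smul₀, Real.norm_of_nonneg hk.le]
        field_simp

theorem isFixedPt_of_tendsto [l.NeBot] (hrec : IsRecessionFunction f g) {K : NNReal}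
    (hf : LipschitzWith K f) {a c : ι → ℝ} {w : ι → Fin n → ℝ} {c₀ : ℝ} {z : Fin n → ℝ}
    (ha : Tendsto a l (𝓝 1)) (hc : Tendsto c l (𝓝 c₀)) (hw : Tendsto (‖w ·‖) l atTop)
    (hz : Tendsto (fun k => ‖w k‖⁻¹ • w k) l (𝓝 z))
    (heq : ∀ᶠ k in l, f (a k • w k) = fun i => c k + w k i) : Function.IsFixedPt g z := by
  have hμ : Tendsto (fun k => a k * ‖w k‖) l atTop := ha.pos_mul_atTop one_pos hw
  refine tendsto_nhds_unique (hrec.tendsto_inv_smul_map_smul hf hμ hz) ?_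
  have hlim : Tendsto (fun k i => (a k * ‖w k‖)⁻¹ * c k + (a k)⁻¹ * (‖w k‖⁻¹ • w k) i) l
      (𝓝 z) := by
    refine tendsto_pi_nhds.2 fun i => ?_
    simpa using (hμ.inv_tendsto_atTop.mul hc).add
      ((ha.inv₀ one_ne_zero).mul (tendsto_pi_nhds.1 hz i))
  refine hlim.congr' ?_
  filter_upwards [heq, hw.eventually_gt_atTop 0] with k hk hwk
  rw [mul_smul, smul_inv_smul₀ hwk.ne', hk]
  funext i
  simp only [Pi.smul_apply, smul_eq_mul]
  ring

theorem exists_isAddEigenvector (hrec : IsRecessionFunction f g) (hmono : Monotone f)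
    (hhom : AddHomogeneous f) (hfix : ∀ z, Function.IsFixedPt g z → ∀ i j, z i = z j) :
    ∃ v, IsAddEigenvector f v := by
  rcases eq_or_ne n 0 with rfl | hn
  · exact ⟨0, 0, Subsingleton.elim _ _⟩
  have : NeZero n := ⟨hn⟩
  have hf := hhom.lipschitzWith_one hmono
  choose! w c hw₀ hc heq using fun a (ha : a ∈ Set.Ico (0 : ℝ) 1) =>
    hhom.exists_map_smul_eq_add hf 0 ha
  let U : Ultrafilter ℝ := .of (𝓝[<] 1)
  have hU : (U : Filter ℝ) ≤ 𝓝[<] 1 := Ultrafilter.of_le _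
  have hIco : ∀ᶠ a in (U : Filter ℝ), a ∈ Set.Ico (0 : ℝ) 1 := hU (Ico_mem_nhdsLT one_pos)
  have hlim : Tendsto (fun a : ℝ => a) U (𝓝 1) := hU.trans nhdsWithin_le_nhds
  replace heq := hIco.mono heq
  obtain ⟨c₀, -, hc₀⟩ := exists_mem_tendsto_of_isCompact (isCompact_closedBall (0 : ℝ) ‖f 0‖)
    (hIco.mono fun a ha => mem_closedBall_zero_iff.2 (hc a ha))
  rcases tendsto_atTop_or_exists_eventually_le U (‖w ·‖) with hw | ⟨B, hB⟩
  · exfalso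
    obtain ⟨z, hz_norm, hz⟩ := exists_norm_eq_one_tendsto_inv_norm_smul
      ((hw.eventually_gt_atTop 0).mono fun a => norm_pos_iff.1)
    have hz_const := hfix z (hrec.isFixedPt_of_tendsto hf hlim hc₀ hw hz heq)
    have hz₀ : z 0 = 0 := tendsto_nhds_unique (tendsto_pi_nhds.1 hz 0) <|
      tendsto_const_nhds.congr' <| hIco.mono fun a ha => by simp [hw₀ a ha]
    have hz_zero : z = 0 := funext fun i => (hz_const i 0).trans hz₀
    simp [hz_zero] at hz_norm
  · obtain ⟨v, -, hv⟩ := exists_mem_tendsto_of_isCompact (isCompact_closedBall 0 B)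
      (hB.mono fun a => mem_closedBall_zero_iff.2)
    exact ⟨v, c₀, map_eq_add_of_tendsto hf.continuous hlim hc₀ hv heq⟩

end IsRecessionFunction

/-- A monotone homogeneous map has an eigenvector if its recession function exists, is convex,
and has only one critical class. -/
theorem corollary1p2 (n : ℕ) (f fhat : (Fin n → ℝ) → (Fin n → ℝ))
    (hf_mono : Monotone f) (hf_hom : AddHomogeneous f)
    (h_rec : IsRecessionFunction f fhat) (h_conv : CoordConvex fhat)
    (h_crit : ∃! C : Set (Fin n), IsCriticalClass fhat C) :
    ∃ v : Fin n → ℝ, IsAddEigenvector f v := by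
  have hg_mono := h_rec.monotone hf_mono
  have hg_hom := h_rec.addHomogeneous hf_hom
  have h_eig : IsAddEigenvector fhat 0 :=
    ⟨0, (map_zero_of_map_smul_of_pos h_rec.map_smul).trans (funext fun _ => (add_zero 0).symm)⟩
  have h_classes : {C | (criticalDigraphAt fhat 0).IsClass C}.Subsingleton :=
    fun _ hC _ hD => h_crit.unique ⟨0, h_eig, hC⟩ ⟨0, h_eig, hD⟩
  exact h_rec.exists_isAddEigenvector hf_mono hf_hom fun _ =>
    apply_eq_of_isFixedPt_of_subsingleton_classes hg_mono hg_hom h_conv h_rec.map_smul h_classes
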